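/- Let $N,n\in\mathbb N$, $m,L\ge 1$ be integers, $\tau,\lambda>0$, $B\ge 0$, $\delta\in(0,1)$, and let $A\in\mathbb R^{n\times N}$ satisfy $\tau\|A\|_{2\to2}^2\le 1$, where $\|\cdot\|_{2\to 2}$ is the spectral norm. For $\theta>0$ let $S_\theta$ be entry-wise soft thresholding, $S_\theta(t)=0$ if $|t|\le\theta$ and $S_\theta(t)=t-\theta\,\mathrm{sign}(t)$ otherwise. For $\Phi\in O(N)$ and $y\in\mathbb R^n$ put \[ f^1_\Phi(y)=S_{\tau\lambda}\big(\tau(A\Phi)^\top y\big),\qquad f^{l+1}_\Phi(y)=S_{\tau\lambda}\big(f^l_\Phi(y)+\tau(A\Phi)^\top(y-A\Phi f^l_\Phi(y))\big)\quad(l\ge 1). \] Let $\sigma:\mathbb R^N\to\mathbb R^N$ be $\sigma(x)=x$ if $\|x\|_2\le B$ and $\sigma(x)=Bx/\|x\|_2$ otherwise, and let \[ \mathcal H_1^L=\{\,y\mapsto\sigma(\Phi f^L_\Phi(y)) : \Phi\in O(N)\,\}. \] Let $\mathcal D$ be a probability distribution on $\mathbb R^N$ with $\|x\|_2\le B$ for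 $\mathcal D$-almost every $x$, let $x_1,\dots,x_m$ be i.i.d. with law $\mathcal D$, and let $y_i=Ax_i$. For $h\in\mathcal H_1^L$ let $\mathcal L(h)=\mathbb E_{x\sim\mathcal D}\|h(Ax)-x\|_2$ and $\hat{\mathcal L}(h)=\frac1m\sum_{i=1}^m\|h(y_i)-x_i\|_2$. Then with probability at least $1-\delta$, for all $h\in\mathcal H_1^L$, \[ \mathcal L(h)\le\hat{\mathcal L}(h)+8B\sqrt{\frac{Nn\log(2+8L(L+3))}{m}}+8B\,\frac{N\sqrt{\log(e+8eL)}}{\sqrt m}+B\sqrt{\frac{128\log(4/\delta)}{m}}. \] Moreover, there is an absolute constant $C>0$ (independent of all the data above) such that, if $L\ge2$, then with probability at least $1-\delta$, for all $h\in\mathcal H_1^L$, \[ |\mathcal L(h)-\hat{\mathcal L}(h)|\le C B\left(\sqrt{\frac{(Nn+N^2)\log L}{m}}+\sqrt{\frac{\log(4/\delta)}{m}}\right). \] -/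

import Mathlib

open MeasureTheory ProbabilityTheory
-- `‖A‖` of a real matrix is its spectral norm (the `ℓ₂ → ℓ₂` operator norm).
open scoped Matrix Matrix.Norms.L2Operator

noncomputable section

namespace UnfoldedISTA

/-- The scalar soft-thresholding (shrinkage) function `S_θ`. -/
def shrink (θ x : ℝ) : ℝ :=
  if |x| ≤ θ then 0 else x - θ * Real.sign x

/-- `S_θ` applied entry-wise to a vector. -/
def shrinkVec {N : ℕ} (θ : ℝ) (v : EuclideanSpace ℝ (Fin N)) : EuclideanSpace ℝ (Fin N) :=
  WithLp.toLp 2 fun i => shrink θ (v i)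

/-- The action of a matrix on Euclidean vectors. -/
def act {k l : ℕ} (M : Matrix (Fin k) (Fin l) ℝ) (v : EuclideanSpace ℝ (Fin l)) :
    EuclideanSpace ℝ (Fin k) :=
  Matrix.toEuclideanLin M v

/-- First layer: `f₁(y) = S_{τλ}(τ (AΦ)ᵀ y)`. -/
def firstLayer {N n : ℕ} (A : Matrix (Fin n) (Fin N) ℝ) (τ lam : ℝ)
    (Φ : Matrix (Fin N) (Fin N) ℝ) (y : EuclideanSpace ℝ (Fin n)) : EuclideanSpace ℝ (Fin N) :=
  shrinkVec (τ * lam) (τ • act (A * Φ)ᵀ y)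

/-- Every later layer: `z ↦ S_{τλ}(z + τ (AΦ)ᵀ (y - AΦ z))`. -/
def layer {N n : ℕ} (A : Matrix (Fin n) (Fin N) ℝ) (τ lam : ℝ)
    (Φ : Matrix (Fin N) (Fin N) ℝ) (y : EuclideanSpace ℝ (Fin n))
    (z : EuclideanSpace ℝ (Fin N)) : EuclideanSpace ℝ (Fin N) :=
  shrinkVec (τ * lam) (z + τ • act (A * Φ)ᵀ (y - act (A * Φ) z))

/-- `f_Φ^L(y) = f_L ∘ ⋯ ∘ f₁ (y)`, meaningful for `L ≥ 1` layers
(the value at `L = 0` is the ISTA initialization `0`). -/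
def network {N n : ℕ} (A : Matrix (Fin n) (Fin N) ℝ) (τ lam : ℝ)
    (Φ : Matrix (Fin N) (Fin N) ℝ) (y : EuclideanSpace ℝ (Fin n)) :
    ℕ → EuclideanSpace ℝ (Fin N)
  | 0 => 0
  | 1 => firstLayer A τ lam Φ y
  | l + 2 => layer A τ lam Φ y (network A τ lam Φ y (l + 1))

/-- The radial clipping `σ` onto the `ℓ₂`-ball of radius `B`. -/
def clip {N : ℕ} (B : ℝ) (x : EuclideanSpace ℝ (Fin N)) : EuclideanSpace ℝ (Fin N) :=
  if ‖x‖ ≤ B then x else (B / ‖x‖) • x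

/-- The hypothesis class `H₁^L = {σ ∘ h : h(y) = Φ f_Φ^L(y), Φ ∈ O(N)}`. -/
def hypothesisClass {N n : ℕ} (A : Matrix (Fin n) (Fin N) ℝ) (τ lam B : ℝ) (L : ℕ) :
    Set (EuclideanSpace ℝ (Fin n) → EuclideanSpace ℝ (Fin N)) :=
  {h | ∃ Φ ∈ Matrix.orthogonalGroup (Fin N) ℝ,
    h = fun y => clip B (act Φ (network A τ lam Φ y L))}

/-- The loss `ℓ(h, x, y) = ‖h(y) - x‖₂`. -/
def loss {N n : ℕ} (h : EuclideanSpace ℝ (Fin n) → EuclideanSpace ℝ (Fin N))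
    (x : EuclideanSpace ℝ (Fin N)) (y : EuclideanSpace ℝ (Fin n)) : ℝ :=
  ‖h y - x‖

/-- The empirical loss on the training sequence `(x_j, y_j)`. -/
def empiricalLoss {N n m : ℕ} (h : EuclideanSpace ℝ (Fin n) → EuclideanSpace ℝ (Fin N))
    (x : Fin m → EuclideanSpace ℝ (Fin N)) (y : Fin m → EuclideanSpace ℝ (Fin n)) : ℝ :=
  (1 / (m : ℝ)) * ∑ j, loss h (x j) (y j)

/-- The true loss for signals `x` with law `D` and measurements `y = A x`. -/
def trueLoss {N n : ℕ} (A : Matrix (Fin n) (Fin N) ℝ) (D : Measure (EuclideanSpace ℝ (Fin N)))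
    (h : EuclideanSpace ℝ (Fin n) → EuclideanSpace ℝ (Fin N)) : ℝ :=
  ∫ x, loss h x (act A x) ∂D

end UnfoldedISTA

end

namespace UnfoldedISTA

/-! ### Layer estimates and Lipschitz dependence of the loss on the dictionary. -/

section Deterministic

variable {N n k l : ℕ}

/-! Let u_j = Φ f^j be the synthesized signal. Orthogonality turns the layers into u_{j+1} = Φ S(Φᵀ
G(u_j)) with a gradient step G free of Φ (`network_succ`). As τ‖A‖² ≤ 1, G is nonexpansive
(`norm_gradStep_sub_le`), and so are thresholding and clipping. Perturbations of Φ therefore add up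
over the layers instead of multiplying, and the loss is B L(L+1)-Lipschitz in Φ
(`abs_dictLoss_sub_le`).

O(N) lies in the spectral unit ball of an N²-dimensional space, so it has ε-nets of size (1 +
2/ε)^(N²) (`exists_net_card_le`). Chaining along such nets, with Hoeffding's inequality and a union
bound on every link (`measure_not_forall_abs_gap_le`), controls the deviation for all Φ at once, on
both sides, by 4B(√2 N √log(e + 8eL) + √log(4/δ))/√m. Both conclusions are read off from this single
event; their Nn contributions are slack. -/

lemma act_add (M : Matrix (Fin k) (Fin l) ℝ) (v w : EuclideanSpace ℝ (Fin l)) :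
    act M (v + w) = act M v + act M w := map_add _ _ _

lemma act_sub (M : Matrix (Fin k) (Fin l) ℝ) (v w : EuclideanSpace ℝ (Fin l)) :
    act M (v - w) = act M v - act M w := map_sub _ _ _

lemma act_smul (M : Matrix (Fin k) (Fin l) ℝ) (c : ℝ) (v : EuclideanSpace ℝ (Fin l)) :
    act M (c • v) = c • act M v := map_smul _ _ _

lemma act_zero (M : Matrix (Fin k) (Fin l) ℝ) : act M 0 = 0 := map_zero _

lemma act_sub_matrix (M M' : Matrix (Fin k) (Fin l) ℝ) (v : EuclideanSpace ℝ (Fin l)) :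
    act (M - M') v = act M v - act M' v := by
  simp [act, map_sub]

lemma act_mul (M : Matrix (Fin k) (Fin l) ℝ) (M' : Matrix (Fin l) (Fin n) ℝ)
    (v : EuclideanSpace ℝ (Fin n)) : act (M * M') v = act M (act M' v) := by
  simp [act, Matrix.toLpLin_apply, Matrix.mulVec_mulVec]

lemma act_one (v : EuclideanSpace ℝ (Fin n)) : act 1 v = v := by
  simp [act]

lemma continuous_act (M : Matrix (Fin k) (Fin l) ℝ) : Continuous (act M) :=
  (Matrix.toEuclideanLin M).continuous_of_finiteDimensional

lemma norm_act_le (M : Matrix (Fin k) (Fin l) ℝ) (v : EuclideanSpace ℝ (Fin l)) :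
    ‖act M v‖ ≤ ‖M‖ * ‖v‖ :=
  Matrix.l2_opNorm_mulVec M v

lemma norm_transpose_eq (M : Matrix (Fin k) (Fin l) ℝ) : ‖Mᵀ‖ = ‖M‖ := by
  rw [← Matrix.conjTranspose_eq_transpose_of_trivial, Matrix.l2_opNorm_conjTranspose]

lemma inner_act_left (M : Matrix (Fin k) (Fin l) ℝ) (v : EuclideanSpace ℝ (Fin l))
    (w : EuclideanSpace ℝ (Fin k)) : inner ℝ (act M v) w = inner ℝ v (act Mᵀ w) := by
  rw [act, act, ← Matrix.conjTranspose_eq_transpose_of_trivial,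
    Matrix.toEuclideanLin_conjTranspose_eq_adjoint, LinearMap.adjoint_inner_right]

lemma act_transpose_act {Φ : Matrix (Fin N) (Fin N) ℝ}
    (hΦ : Φ ∈ Matrix.orthogonalGroup (Fin N) ℝ) (v : EuclideanSpace ℝ (Fin N)) :
    act Φᵀ (act Φ v) = v := by
  rw [← act_mul, (Matrix.mem_orthogonalGroup_iff' (Fin N) ℝ).1 hΦ, act_one]

lemma act_act_transpose {Φ : Matrix (Fin N) (Fin N) ℝ}
    (hΦ : Φ ∈ Matrix.orthogonalGroup (Fin N) ℝ) (v : EuclideanSpace ℝ (Fin N)) :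
    act Φ (act Φᵀ v) = v := by
  rw [← act_mul, (Matrix.mem_orthogonalGroup_iff (Fin N) ℝ).1 hΦ, act_one]

lemma norm_act_of_mem {Φ : Matrix (Fin N) (Fin N) ℝ}
    (hΦ : Φ ∈ Matrix.orthogonalGroup (Fin N) ℝ) (v : EuclideanSpace ℝ (Fin N)) :
    ‖act Φ v‖ = ‖v‖ := by
  have h : ‖act Φ v‖ ^ 2 = ‖v‖ ^ 2 := by
    rw [← real_inner_self_eq_norm_sq, inner_act_left, act_transpose_act hΦ,
      real_inner_self_eq_norm_sq]
  exact (sq_eq_sq₀ (norm_nonneg _) (norm_nonneg _)).1 h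

lemma norm_act_transpose_of_mem {Φ : Matrix (Fin N) (Fin N) ℝ}
    (hΦ : Φ ∈ Matrix.orthogonalGroup (Fin N) ℝ) (v : EuclideanSpace ℝ (Fin N)) :
    ‖act Φᵀ v‖ = ‖v‖ := by
  rw [← norm_act_of_mem hΦ, act_act_transpose hΦ]

lemma norm_le_one_of_mem_orthogonalGroup {Φ : Matrix (Fin N) (Fin N) ℝ}
    (hΦ : Φ ∈ Matrix.orthogonalGroup (Fin N) ℝ) : ‖Φ‖ ≤ 1 := by
  rw [Matrix.l2_opNorm_def]
  exact ContinuousLinearMap.opNorm_le_bound _ zero_le_one fun v => by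
    rw [one_mul]; exact (norm_act_of_mem hΦ v).le

/-- For θ ≥ 0, `shrink` is a difference of two positive parts whose supports are disjoint, so its
slope is 0 or 1 everywhere. -/
lemma abs_shrink_sub_le {θ : ℝ} (hθ : 0 ≤ θ) (x y : ℝ) :
    |shrink θ x - shrink θ y| ≤ |x - y| := by
  have key : ∀ x, shrink θ x = max (x - θ) 0 - max (-x - θ) 0 := by
    intro x
    unfold shrink
    rcases lt_trichotomy x 0 with h | h | h
    · rw [Real.sign_of_neg h, abs_of_neg h]; grind
    · subst h; simp [hθ]
    · rw [Real.sign_of_pos h, abs_of_pos h]; grind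
  rw [key, key]
  grind

lemma shrink_zero (θ : ℝ) : shrink θ 0 = 0 := by
  simp [shrink]

lemma norm_shrinkVec_sub_le {θ : ℝ} (hθ : 0 ≤ θ) (v w : EuclideanSpace ℝ (Fin N)) :
    ‖shrinkVec θ v - shrinkVec θ w‖ ≤ ‖v - w‖ := by
  rw [EuclideanSpace.norm_eq, EuclideanSpace.norm_eq]
  gcongr with i
  exact abs_shrink_sub_le hθ (v i) (w i)

lemma shrinkVec_zero (θ : ℝ) : shrinkVec θ (0 : EuclideanSpace ℝ (Fin N)) = 0 := by
  ext i; simp [shrinkVec, shrink_zero]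

lemma norm_shrinkVec_le {θ : ℝ} (hθ : 0 ≤ θ) (v : EuclideanSpace ℝ (Fin N)) :
    ‖shrinkVec θ v‖ ≤ ‖v‖ := by
  simpa [shrinkVec_zero] using norm_shrinkVec_sub_le hθ v 0

lemma continuous_shrinkVec {θ : ℝ} (hθ : 0 ≤ θ) :
    Continuous (shrinkVec θ : EuclideanSpace ℝ (Fin N) → _) :=
  (LipschitzWith.of_dist_le_mul (K := 1) fun v w => by
    simpa [dist_eq_norm] using norm_shrinkVec_sub_le hθ v w).continuous

lemma norm_clip_le {B : ℝ} (hB : 0 ≤ B) (x : EuclideanSpace ℝ (Fin N)) : ‖clip B x‖ ≤ B := by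
  unfold clip
  split_ifs with h
  · exact h
  · have hx : 0 < ‖x‖ := hB.trans_lt (not_le.1 h)
    rw [norm_smul, Real.norm_of_nonneg (by positivity), div_mul_cancel₀ _ hx.ne']

/-- The variational inequality characterizing `clip B` as the projection onto a ball. -/
lemma inner_sub_clip_nonpos {B : ℝ} (hB : 0 ≤ B) (x z : EuclideanSpace ℝ (Fin N))
    (hz : ‖z‖ ≤ B) : inner ℝ (z - clip B x) (x - clip B x) ≤ 0 := by
  unfold clip
  split_ifs with h
  · simp
  · have h := not_le.1 h
    have hx : 0 < ‖x‖ := hB.trans_lt h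
    have e : x - (B / ‖x‖) • x = (1 - B / ‖x‖) • x := by rw [sub_smul, one_smul]
    have h1 : 0 ≤ 1 - B / ‖x‖ := by rw [sub_nonneg, div_le_one hx]; exact h.le
    rw [e, inner_smul_right, inner_sub_left, inner_smul_left, real_inner_self_eq_norm_sq]
    refine mul_nonpos_of_nonneg_of_nonpos h1 ?_
    have h2 : inner ℝ z x ≤ B * ‖x‖ := (real_inner_le_norm z x).trans (by gcongr)
    have h3 : (B / ‖x‖) * ‖x‖ ^ 2 = B * ‖x‖ := by field_simp
    simp only [conj_trivial]
    linarith

/-- Add the variational inequalities at x and at y, each tested against the other's projection, then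
apply Cauchy–Schwarz. -/
lemma norm_clip_sub_le {B : ℝ} (hB : 0 ≤ B) (x y : EuclideanSpace ℝ (Fin N)) :
    ‖clip B x - clip B y‖ ≤ ‖x - y‖ := by
  have h1 := inner_sub_clip_nonpos hB x (clip B y) (norm_clip_le hB y)
  have h2 := inner_sub_clip_nonpos hB y (clip B x) (norm_clip_le hB x)
  have h3 : inner ℝ (clip B x - clip B y) (clip B x - clip B y) ≤
      inner ℝ (clip B x - clip B y) (x - y) := by
    simp only [inner_sub_left, inner_sub_right] at h1 h2 ⊢
    linarith
  rw [real_inner_self_eq_norm_sq] at h3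
  have h4 := h3.trans (real_inner_le_norm _ _)
  rcases (norm_nonneg (clip B x - clip B y)).eq_or_lt with h | h
  · rw [← h]; positivity
  · rw [sq] at h4
    exact le_of_mul_le_mul_left h4 h

lemma continuous_clip {B : ℝ} (hB : 0 ≤ B) :
    Continuous (clip B : EuclideanSpace ℝ (Fin N) → _) :=
  (LipschitzWith.of_dist_le_mul (K := 1) fun v w => by
    simpa [dist_eq_norm] using norm_clip_sub_le hB v w).continuous

/-- The gradient step `w ↦ w + τ Aᵀ (y - A w)`. -/
noncomputable def gradStep (A : Matrix (Fin n) (Fin N) ℝ) (τ : ℝ) (y : EuclideanSpace ℝ (Fin n))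
    (w : EuclideanSpace ℝ (Fin N)) : EuclideanSpace ℝ (Fin N) :=
  w + τ • act Aᵀ (y - act A w)

/-- Inserting z = ΦᵀΦz pulls Φᵀ out of the gradient step. The value 0 at index 0 makes the first
layer an instance of the same recursion. -/
lemma network_succ {A : Matrix (Fin n) (Fin N) ℝ} {τ lam : ℝ} {Φ : Matrix (Fin N) (Fin N) ℝ}
    (hΦ : Φ ∈ Matrix.orthogonalGroup (Fin N) ℝ) (y : EuclideanSpace ℝ (Fin n)) (j : ℕ) :
    network A τ lam Φ y (j + 1) =
      shrinkVec (τ * lam) (act Φᵀ (gradStep A τ y (act Φ (network A τ lam Φ y j)))) := by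
  cases j with
  | zero =>
    simp [network, firstLayer, gradStep, act_zero, act_smul, act_mul]
  | succ j =>
    simp [network, layer, gradStep, act_smul, act_add, act_mul, act_transpose_act hΦ]

/-- The linear part is I − τAᵀA. Expanding the square, τ²‖AᵀAu‖² ≤ τ‖Au‖² is absorbed by the cross
term −2τ‖Au‖². -/
lemma norm_gradStep_sub_le {A : Matrix (Fin n) (Fin N) ℝ} {τ : ℝ} (hτ : 0 < τ)
    (hA : τ * ‖A‖ ^ 2 ≤ 1) (y : EuclideanSpace ℝ (Fin n)) (v w : EuclideanSpace ℝ (Fin N)) :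
    ‖gradStep A τ y v - gradStep A τ y w‖ ≤ ‖v - w‖ := by
  set u := v - w with hu
  have e : gradStep A τ y v - gradStep A τ y w = u - τ • act Aᵀ (act A u) := by
    simp only [gradStep, hu, act_sub, smul_sub]
    abel
  rw [e]
  refine abs_le_of_sq_le_sq' ?_ (norm_nonneg _) |>.2
  have h1 : inner ℝ u (act Aᵀ (act A u)) = ‖act A u‖ ^ 2 := by
    rw [← inner_act_left, real_inner_self_eq_norm_sq]
  have h2 : ‖act Aᵀ (act A u)‖ ≤ ‖A‖ * ‖act A u‖ := by
    simpa [norm_transpose_eq] using norm_act_le Aᵀ (act A u)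
  have h3 : ‖act Aᵀ (act A u)‖ ^ 2 ≤ ‖A‖ ^ 2 * ‖act A u‖ ^ 2 := by
    rw [← mul_pow]; gcongr
  have h4 : τ * ‖act Aᵀ (act A u)‖ ^ 2 ≤ ‖act A u‖ ^ 2 := by
    calc τ * ‖act Aᵀ (act A u)‖ ^ 2 ≤ τ * (‖A‖ ^ 2 * ‖act A u‖ ^ 2) := by gcongr
      _ = (τ * ‖A‖ ^ 2) * ‖act A u‖ ^ 2 := by ring
      _ ≤ 1 * ‖act A u‖ ^ 2 := by gcongr
      _ = _ := one_mul _
  rw [norm_sub_sq_real, inner_smul_right, h1, norm_smul, Real.norm_of_nonneg hτ.le, mul_pow]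
  nlinarith [mul_le_mul_of_nonneg_left h4 hτ.le, sq_nonneg ‖act A u‖]

lemma norm_gradStep_le {A : Matrix (Fin n) (Fin N) ℝ} {τ B : ℝ} (hτ : 0 < τ)
    (hA : τ * ‖A‖ ^ 2 ≤ 1) {x : EuclideanSpace ℝ (Fin N)} (hx : ‖x‖ ≤ B)
    (w : EuclideanSpace ℝ (Fin N)) : ‖gradStep A τ (act A x) w‖ ≤ ‖w‖ + B := by
  have h1 := norm_gradStep_sub_le hτ hA (act A x) w 0
  have h2 : ‖gradStep A τ (act A x) 0‖ ≤ B := by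
    have e : gradStep A τ (act A x) 0 = τ • act Aᵀ (act A x) := by simp [gradStep, act_zero]
    rw [e, norm_smul, Real.norm_of_nonneg hτ.le]
    calc τ * ‖act Aᵀ (act A x)‖ ≤ τ * (‖A‖ * (‖A‖ * ‖x‖)) := by
          gcongr
          refine (norm_act_le _ _).trans ?_
          rw [norm_transpose_eq]
          gcongr
          exact norm_act_le _ _
      _ = (τ * ‖A‖ ^ 2) * ‖x‖ := by ring
      _ ≤ 1 * ‖x‖ := by gcongr
      _ ≤ B := by simpa using hx
  rw [sub_zero] at h1
  have h3 := norm_sub_norm_le (gradStep A τ (act A x) w) (gradStep A τ (act A x) 0)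
  linarith

lemma norm_network_le {A : Matrix (Fin n) (Fin N) ℝ} {τ lam B : ℝ} (hτ : 0 < τ) (hlam : 0 < lam)
    (hA : τ * ‖A‖ ^ 2 ≤ 1) {Φ : Matrix (Fin N) (Fin N) ℝ}
    (hΦ : Φ ∈ Matrix.orthogonalGroup (Fin N) ℝ) {x : EuclideanSpace ℝ (Fin N)} (hx : ‖x‖ ≤ B)
    (j : ℕ) : ‖network A τ lam Φ (act A x) j‖ ≤ j * B := by
  induction j with
  | zero => simp [network]
  | succ j ih =>
    rw [network_succ hΦ]
    refine (norm_shrinkVec_le (by positivity) _).trans ?_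
    rw [norm_act_transpose_of_mem hΦ]
    refine (norm_gradStep_le hτ hA hx _).trans ?_
    rw [norm_act_of_mem hΦ]
    push_cast
    linarith

/-- The synthesized signal depends on the dictionary in a Lipschitz way. -/
lemma norm_act_network_sub_le {A : Matrix (Fin n) (Fin N) ℝ} {τ lam B : ℝ} (hτ : 0 < τ)
    (hlam : 0 < lam) (hA : τ * ‖A‖ ^ 2 ≤ 1) {Φ Ψ : Matrix (Fin N) (Fin N) ℝ}
    (hΦ : Φ ∈ Matrix.orthogonalGroup (Fin N) ℝ) (hΨ : Ψ ∈ Matrix.orthogonalGroup (Fin N) ℝ)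
    {x : EuclideanSpace ℝ (Fin N)} (hx : ‖x‖ ≤ B) (j : ℕ) :
    ‖act Φ (network A τ lam Φ (act A x) j) - act Ψ (network A τ lam Ψ (act A x) j)‖ ≤
      j * (j + 1) * B * ‖Φ - Ψ‖ := by
  induction j with
  | zero => simp [network, act_zero]
  | succ j ih =>
    have hθ : 0 ≤ τ * lam := by positivity
    set y := act A x
    set v := gradStep A τ y (act Φ (network A τ lam Φ y j)) with hv
    set v' := gradStep A τ y (act Ψ (network A τ lam Ψ y j)) with hv'
    have hv'n : ‖v'‖ ≤ (j + 1) * B := by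
      refine (norm_gradStep_le hτ hA hx _).trans ?_
      rw [norm_act_of_mem hΨ]
      linarith [norm_network_le (lam := lam) hτ hlam hA hΨ hx j]
    rw [network_succ hΦ, network_succ hΨ, ← hv, ← hv']
    -- Change one ingredient at a time: the input, the inner transpose, the outer dictionary. The
    -- first costs the inductive bound and the others (j+1)B‖Φ − Ψ‖ each, and j(j+1) + 2(j+1) =
    -- (j+1)(j+2).
    have e : act Φ (shrinkVec (τ * lam) (act Φᵀ v)) - act Ψ (shrinkVec (τ * lam) (act Ψᵀ v')) =
        act Φ (shrinkVec (τ * lam) (act Φᵀ v) - shrinkVec (τ * lam) (act Φᵀ v')) +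
        act Φ (shrinkVec (τ * lam) (act Φᵀ v') - shrinkVec (τ * lam) (act Ψᵀ v')) +
        act (Φ - Ψ) (shrinkVec (τ * lam) (act Ψᵀ v')) := by
      simp only [act_sub, act_sub_matrix]; abel
    rw [e]
    have h1 : ‖act Φ (shrinkVec (τ * lam) (act Φᵀ v) - shrinkVec (τ * lam) (act Φᵀ v'))‖ ≤
        j * (j + 1) * B * ‖Φ - Ψ‖ := by
      rw [norm_act_of_mem hΦ]
      refine (norm_shrinkVec_sub_le hθ _ _).trans ?_
      rw [← act_sub, norm_act_transpose_of_mem hΦ]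
      exact (norm_gradStep_sub_le hτ hA _ _ _).trans ih
    have h2 : ‖act Φ (shrinkVec (τ * lam) (act Φᵀ v') - shrinkVec (τ * lam) (act Ψᵀ v'))‖ ≤
        ‖Φ - Ψ‖ * ((j + 1) * B) := by
      rw [norm_act_of_mem hΦ]
      refine (norm_shrinkVec_sub_le hθ _ _).trans ?_
      rw [← act_sub_matrix, ← Matrix.transpose_sub]
      refine (norm_act_le _ _).trans ?_
      rw [norm_transpose_eq]
      gcongr
    have h3 : ‖act (Φ - Ψ) (shrinkVec (τ * lam) (act Ψᵀ v'))‖ ≤ ‖Φ - Ψ‖ * ((j + 1) * B) := by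
      refine (norm_act_le _ _).trans ?_
      gcongr
      refine (norm_shrinkVec_le hθ _).trans ?_
      rwa [norm_act_transpose_of_mem hΨ]
    refine (norm_add₃_le).trans ?_
    push_cast
    linarith

lemma continuous_network (A : Matrix (Fin n) (Fin N) ℝ) {τ lam : ℝ} (h : 0 ≤ τ * lam)
    {Φ : Matrix (Fin N) (Fin N) ℝ} (hΦ : Φ ∈ Matrix.orthogonalGroup (Fin N) ℝ) (j : ℕ) :
    Continuous fun y => network A τ lam Φ y j := by
  induction j with
  | zero => exact continuous_const
  | succ j ih =>
    simp only [network_succ hΦ]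
    refine (continuous_shrinkVec h).comp ((continuous_act _).comp ?_)
    have h1 := (continuous_act Φ).comp ih
    exact h1.add (((continuous_act _).comp
      (continuous_id.sub ((continuous_act A).comp h1))).const_smul τ)

/-- The loss of the hypothesis with dictionary `Φ` at the signal `x`. -/
noncomputable def dictLoss (A : Matrix (Fin n) (Fin N) ℝ) (τ lam B : ℝ) (L : ℕ)
    (Φ : Matrix (Fin N) (Fin N) ℝ) (x : EuclideanSpace ℝ (Fin N)) : ℝ :=
  loss (fun y => clip B (act Φ (network A τ lam Φ y L))) x (act A x)

lemma continuous_dictLoss (A : Matrix (Fin n) (Fin N) ℝ) {τ lam B : ℝ} (h : 0 ≤ τ * lam)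
    (hB : 0 ≤ B) (L : ℕ) {Φ : Matrix (Fin N) (Fin N) ℝ}
    (hΦ : Φ ∈ Matrix.orthogonalGroup (Fin N) ℝ) : Continuous (dictLoss A τ lam B L Φ) := by
  unfold dictLoss loss
  exact (((continuous_clip hB).comp ((continuous_act Φ).comp
    ((continuous_network A h hΦ L).comp (continuous_act A)))).sub continuous_id).norm

lemma dictLoss_mem_Icc (A : Matrix (Fin n) (Fin N) ℝ) (τ lam : ℝ) {B : ℝ} (L : ℕ)
    (Φ : Matrix (Fin N) (Fin N) ℝ) {x : EuclideanSpace ℝ (Fin N)} (hx : ‖x‖ ≤ B) :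
    dictLoss A τ lam B L Φ x ∈ Set.Icc 0 (2 * B) := by
  refine ⟨norm_nonneg _, (norm_sub_le _ _).trans ?_⟩
  have := norm_clip_le ((norm_nonneg x).trans hx) (act Φ (network A τ lam Φ (act A x) L))
  linarith

lemma abs_dictLoss_sub_le {A : Matrix (Fin n) (Fin N) ℝ} {τ lam B : ℝ} (hτ : 0 < τ)
    (hlam : 0 < lam) (hA : τ * ‖A‖ ^ 2 ≤ 1) (L : ℕ) {Φ Ψ : Matrix (Fin N) (Fin N) ℝ}
    (hΦ : Φ ∈ Matrix.orthogonalGroup (Fin N) ℝ) (hΨ : Ψ ∈ Matrix.orthogonalGroup (Fin N) ℝ)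
    {x : EuclideanSpace ℝ (Fin N)} (hx : ‖x‖ ≤ B) :
    |dictLoss A τ lam B L Φ x - dictLoss A τ lam B L Ψ x| ≤ B * (L * (L + 1)) * dist Φ Ψ := by
  refine (abs_norm_sub_norm_le _ _).trans ?_
  rw [sub_sub_sub_cancel_right]
  refine (norm_clip_sub_le ((norm_nonneg x).trans hx) _ _).trans ?_
  refine (norm_act_network_sub_le hτ hlam hA hΦ hΨ hx L).trans_eq ?_
  rw [dist_eq_norm]; ring

end Deterministic

/-! ### Volumetric covering numbers. -/

section Nets

open Metric Module

variable {E : Type*} [NormedAddCommGroup E] [NormedSpace ℝ E] [FiniteDimensional ℝ E]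

/-- The volumetric bound for separated subsets of the unit ball. -/
lemma card_le_of_separated_unitBall {ε : ℝ} (hε : 0 < ε) (s : Finset E) (hs : ∀ c ∈ s, ‖c‖ ≤ 1)
    (h : ∀ c ∈ s, ∀ d ∈ s, c ≠ d → ε ≤ dist c d) :
    (s.card : ℝ) ≤ (1 + 2 / ε) ^ finrank ℝ E := by
  borelize E
  let μ : Measure E := Measure.addHaar
  have hr : 0 < ε / 2 := by positivity
  have hρ : 0 < 1 + ε / 2 := by positivity
  -- Balls of radius ε/2 around the points are disjoint and lie in the ball of radius 1 + ε/2;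
  -- compare Haar measures.
  have D : Set.Pairwise (s : Set E) (Function.onFun Disjoint fun c => ball (c : E) (ε / 2)) := by
    intro c hc d hd hcd
    apply ball_disjoint_ball
    rw [add_halves]
    exact h c hc d hd hcd
  have hsub : (⋃ c ∈ s, ball (c : E) (ε / 2)) ⊆ ball (0 : E) (1 + ε / 2) := by
    refine Set.iUnion₂_subset fun x hx => ball_subset_ball' ?_
    rw [dist_zero_right]
    linarith [hs x hx]
  have I : (s.card : ENNReal) * ENNReal.ofReal ((ε / 2) ^ finrank ℝ E) * μ (ball 0 1) ≤
      ENNReal.ofReal ((1 + ε / 2) ^ finrank ℝ E) * μ (ball 0 1) := by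
    have h1 := measure_mono (μ := μ) hsub
    rw [measure_biUnion_finset D fun c _ => measurableSet_ball] at h1
    simpa only [μ.addHaar_ball_of_pos _ hr, μ.addHaar_ball_of_pos _ hρ, Finset.sum_const,
      nsmul_eq_mul, mul_assoc] using h1
  have J := (ENNReal.mul_le_mul_iff_left (measure_ball_pos μ _ zero_lt_one).ne'
    measure_ball_lt_top.ne).1 I
  have K := ENNReal.toReal_le_of_le_ofReal (pow_nonneg hρ.le _) J
  rw [ENNReal.toReal_mul, ENNReal.toReal_natCast, ENNReal.toReal_ofReal (by positivity),
    ← le_div_iff₀ (by positivity), ← div_pow] at K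
  refine K.trans_eq ?_
  congr 1
  field_simp
  ring

/-- Subsets of the unit ball have internal nets of the volumetric size. -/
lemma exists_net_card_le {S : Set E} (hS : ∀ x ∈ S, ‖x‖ ≤ 1) {ε : ℝ} (hε : 0 < ε) :
    ∃ T : Finset E, (∀ x ∈ T, x ∈ S) ∧ (∀ x ∈ S, ∃ y ∈ T, dist x y ≤ ε) ∧
      (T.card : ℝ) ≤ (1 + 2 / ε) ^ finrank ℝ E := by
  classical
  let Q : ℕ → Prop := fun c => ∃ T : Finset E, (∀ x ∈ T, x ∈ S) ∧
    (∀ x ∈ T, ∀ y ∈ T, x ≠ y → ε ≤ dist x y) ∧ T.card = c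
  let M : ℕ := ⌊(1 + 2 / ε) ^ finrank ℝ E⌋₊
  have hQM : ∀ c, Q c → c ≤ M := by
    rintro c ⟨T, hTS, hsep, rfl⟩
    exact Nat.le_floor (card_le_of_separated_unitBall hε T (fun x hx => hS x (hTS x hx)) hsep)
  have hQ0 : Q 0 := ⟨∅, by simp, by simp, rfl⟩
  -- A separated subset of maximal cardinality is a net: a point far from all of it could be
  -- inserted.
  obtain ⟨T, hTS, hsep, hcard⟩ : Q (Nat.findGreatest Q M) :=
    Nat.findGreatest_spec (Nat.zero_le M) hQ0
  refine ⟨T, hTS, fun x hx => ?_,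
    card_le_of_separated_unitBall hε T (fun x hx => hS x (hTS x hx)) hsep⟩
  by_contra! hfar
  have hxT : x ∉ T := fun hxT => by
    have := hfar x hxT
    rw [dist_self] at this
    linarith
  have hQs : Q (T.card + 1) := by
    refine ⟨insert x T, ?_, ?_, Finset.card_insert_of_notMem hxT⟩
    · intro z hz
      rcases Finset.mem_insert.1 hz with rfl | hz
      exacts [hx, hTS z hz]
    · intro z hz w hw hzw
      rcases Finset.mem_insert.1 hz with hzx | hz' <;>
        rcases Finset.mem_insert.1 hw with hwx | hw'
      · exact absurd (hzx.trans hwx.symm) hzw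
      · rw [hzx]; exact (hfar w hw').le
      · rw [hwx, dist_comm]; exact (hfar z hz').le
      · exact hsep z hz' w hw' hzw
  have := Nat.le_findGreatest (hQM _ hQs) hQs
  omega

end Nets

/-! ### Hoeffding bounds for a single function. -/

section Gap

variable {E : Type*} [MeasurableSpace E] {m : ℕ}

/-- The difference between the expectation of `f` and its empirical mean over a sample. -/
noncomputable def gap (D : Measure E) (f : E → ℝ) (x : Fin m → E) : ℝ :=
  ∫ z, f z ∂D - (1 / (m : ℝ)) * ∑ j, f (x j)

variable {D : Measure E}

lemma gap_sub {f g : E → ℝ} (hf : Integrable f D) (hg : Integrable g D) (x : Fin m → E) :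
    gap D (f - g) x = gap D f x - gap D g x := by
  simp only [gap, Pi.sub_apply, integral_sub hf hg, Finset.sum_sub_distrib]
  ring

lemma gap_neg (f : E → ℝ) (x : Fin m → E) : gap D (-f) x = -gap D f x := by
  simp only [gap, Pi.neg_apply, integral_neg, Finset.sum_neg_distrib]
  ring

lemma abs_gap_le [IsProbabilityMeasure D] (hm : 1 ≤ m) {f : E → ℝ} {c : ℝ}
    (hf : ∀ᵐ z ∂D, |f z| ≤ c) {x : Fin m → E} (hx : ∀ j, |f (x j)| ≤ c) :
    |gap D f x| ≤ 2 * c := by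
  have h1 : |∫ z, f z ∂D| ≤ c := by
    simpa using norm_integral_le_of_norm_le_const (μ := D) (f := f) hf
  have hm' : (0 : ℝ) < m := by exact_mod_cast hm
  have h2 : |(1 / (m : ℝ)) * ∑ j, f (x j)| ≤ c := by
    rw [abs_mul, abs_of_pos (by positivity : (0 : ℝ) < 1 / m), one_div,
      inv_mul_le_iff₀ hm']
    refine (Finset.abs_sum_le_sum_abs _ _).trans ((Finset.sum_le_sum fun j _ => hx j).trans_eq ?_)
    simp
  unfold gap
  linarith [abs_sub (∫ z, f z ∂D) ((1 / (m : ℝ)) * ∑ j, f (x j))]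

variable {Ω : Type*} [MeasurableSpace Ω] {P : Measure Ω} [IsProbabilityMeasure P]
  {X : Fin m → Ω → E}

/-- One-sided Hoeffding inequality for the empirical mean. -/
lemma measureReal_gap_le_neg (hm : 1 ≤ m) (hX : ∀ i, Measurable (X i)) (hind : iIndepFun X P)
    (hlaw : ∀ i, P.map (X i) = D) {f : E → ℝ} (hf : Measurable f) {a c : ℝ} (hc : 0 < c)
    (hfa : ∀ᵐ z ∂D, f z ∈ Set.Icc a (a + 2 * c)) {t : ℝ} (ht : 0 ≤ t) :
    P.real {ω | gap D f (fun i => X i ω) ≤ -t} ≤ Real.exp (-(m * t ^ 2) / (2 * c ^ 2)) := by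
  have hm' : (0 : ℝ) < m := by exact_mod_cast hm
  let Y : Fin m → Ω → ℝ := fun i ω => f (X i ω) - ∫ z, f z ∂D
  have hmean : ∀ i, ∫ ω, f (X i ω) ∂P = ∫ z, f z ∂D := fun i => by
    rw [← hlaw i, integral_map (hX i).aemeasurable hf.aestronglyMeasurable]
  have hY : ∀ i, HasSubgaussianMGF (Y i) ((‖a + 2 * c - a‖₊ / 2) ^ 2) P := fun i => by
    have h1 : ∀ᵐ ω ∂P, f (X i ω) ∈ Set.Icc a (a + 2 * c) :=
      ae_of_ae_map (hX i).aemeasurable (by rwa [hlaw i])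
    have h2 := hasSubgaussianMGF_of_mem_Icc (hf.comp (hX i)).aemeasurable h1
    simpa only [Function.comp_apply, hmean i] using h2
  have hYind : iIndepFun Y P :=
    hind.comp (fun _ z => f z - ∫ z, f z ∂D) fun _ => hf.sub_const _
  have key := HasSubgaussianMGF.measure_sum_ge_le_of_iIndepFun hYind
    (s := Finset.univ) (fun i _ => hY i) (ε := m * t) (by positivity)
  have hset : {ω | gap D f (fun i => X i ω) ≤ -t} = {ω | m * t ≤ ∑ i, Y i ω} := by
    ext ω
    simp only [Set.mem_ofPred_eq, gap, Y, Finset.sum_sub_distrib, Finset.sum_const,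
      Finset.card_univ, Fintype.card_fin, nsmul_eq_mul]
    rw [← mul_le_mul_iff_right₀ hm']
    have : (m : ℝ) * (∫ z, f z ∂D - 1 / m * ∑ j, f (X j ω)) =
        m * ∫ z, f z ∂D - ∑ j, f (X j ω) := by field_simp
    rw [this]
    constructor <;> intro h <;> linarith
  rw [hset]
  refine key.trans_eq ?_
  congr 1
  have h2c : ((‖a + 2 * c - a‖₊ : NNReal) : ℝ) = 2 * c := by
    rw [add_sub_cancel_left, coe_nnnorm, Real.norm_of_nonneg (by positivity)]
  simp only [Finset.sum_const, Finset.card_univ, Fintype.card_fin, nsmul_eq_mul,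
    NNReal.coe_mul, NNReal.coe_natCast, NNReal.coe_pow, NNReal.coe_div, h2c, NNReal.coe_ofNat]
  field_simp

/-- Two-sided Hoeffding inequality for the empirical mean. -/
lemma measureReal_lt_abs_gap (hm : 1 ≤ m) (hX : ∀ i, Measurable (X i)) (hind : iIndepFun X P)
    (hlaw : ∀ i, P.map (X i) = D) {f : E → ℝ} (hf : Measurable f) {a c : ℝ} (hc : 0 < c)
    (hfa : ∀ᵐ z ∂D, f z ∈ Set.Icc a (a + 2 * c)) {t : ℝ} (ht : 0 ≤ t) :
    P.real {ω | t < |gap D f (fun i => X i ω)|} ≤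
      2 * Real.exp (-(m * t ^ 2) / (2 * c ^ 2)) := by
  have h1 := measureReal_gap_le_neg hm hX hind hlaw hf hc hfa ht
  -- The other tail is the same bound for −f, whose range is the reflected interval.
  have h2 := measureReal_gap_le_neg (a := -(a + 2 * c)) hm hX hind hlaw hf.neg hc
    (by filter_upwards [hfa] with z hz; constructor <;> simp only [Pi.neg_apply] <;>
          linarith [hz.1, hz.2]) ht
  have hsub : {ω | t < |gap D f (fun i => X i ω)|} ⊆
      {ω | gap D f (fun i => X i ω) ≤ -t} ∪ {ω | gap D (-f) (fun i => X i ω) ≤ -t} := by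
    intro ω hω
    simp only [Set.mem_ofPred_eq, Set.mem_union, gap_neg] at hω ⊢
    rcases lt_abs.1 hω with h | h
    · right; linarith
    · left; linarith
  calc _ ≤ _ := measureReal_mono hsub
    _ ≤ _ := measureReal_union_le _ _
    _ ≤ _ := by linarith

end Gap

/-! ### Chaining over a Lipschitz family. -/

section Chaining

variable {E : Type*} [MeasurableSpace E] {m : ℕ} {D : Measure E} [IsProbabilityMeasure D]
  {Ω : Type*} [MeasurableSpace Ω] {P : Measure Ω} [IsProbabilityMeasure P]
  {X : Fin m → Ω → E} {F : Type*} [PseudoMetricSpace F]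

/-- The partial sums stay below 4, the source of the factor in 4R. -/
lemma sum_range_chaining_weights (k : ℕ) :
    ∑ j ∈ Finset.range k, (1 / 2 : ℝ) ^ j * (((j : ℝ) + 3) / 2) =
      4 - (1 / 2 : ℝ) ^ k * (k + 4) := by
  induction k with
  | zero => simp
  | succ k ih => rw [Finset.sum_range_succ, ih, pow_succ]; push_cast; ring

/-- A uniform deviation bound by chaining along nets of geometrically decreasing radius: `g` is a
family of bounded functions that is Lipschitz in its parameter. -/
theorem measure_not_forall_abs_gap_le (hm : 1 ≤ m) (hX : ∀ i, Measurable (X i))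
    (hind : iIndepFun X P) (hlaw : ∀ i, P.map (X i) = D) {S : Set F} {g : F → E → ℝ} {B K : ℝ}
    (hB : 0 < B) (hK : 0 < K) (hg : ∀ Φ ∈ S, Measurable (g Φ))
    (hbdd : ∀ᵐ z ∂D, ∀ Φ ∈ S, g Φ z ∈ Set.Icc 0 (2 * B))
    (hlip : ∀ᵐ z ∂D, ∀ Φ ∈ S, ∀ Ψ ∈ S, |g Φ z - g Ψ z| ≤ B * K * dist Φ Ψ)
    {T : ℕ → Finset F} (hTS : ∀ k, ∀ Φ ∈ T k, Φ ∈ S)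
    (hcover : ∀ k, ∀ Φ ∈ S, ∃ Ψ ∈ T k, dist Φ Ψ ≤ (1 / 2) ^ (k + 1) / K)
    {R δ : ℝ} (hR : 0 ≤ R) (hδ : 0 ≤ δ)
    (hcard : ∀ k : ℕ, ((T k).card : ℝ) *
      (2 * Real.exp (-(m * (((k : ℝ) + 3) / 2 * R) ^ 2) / (2 * B ^ 2))) ≤ δ / 2 * (1 / 2) ^ k) :
    P {ω | ¬ ∀ Φ ∈ S, |gap D (g Φ) (fun i => X i ω)| ≤ 4 * R} ≤ ENNReal.ofReal δ := by
  classical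
  choose! p hpT hpd using hcover
  let t : ℕ → ℝ := fun k => (1 / 2) ^ k * (((k : ℝ) + 3) / 2) * R
  -- Links of the chain: level 0 is the function itself, with range half-width B; level j+1 is the
  -- increment to the nearby point of net j, with half-width at most B·2^{-(j+1)}.
  let G : ℕ → F → E → ℝ := fun k Ψ => Nat.casesOn k (g Ψ) fun j => g Ψ - g (p j Ψ)
  have hint : ∀ Φ ∈ S, Integrable (g Φ) D := fun Φ hΦ =>
    Integrable.of_mem_Icc 0 (2 * B) (hg Φ hΦ).aemeasurable (hbdd.mono fun z hz => hz Φ hΦ)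
  have hstep : ∀ j, ∀ Φ ∈ S, B * K * dist Φ (p j Φ) ≤ B * (1 / 2) ^ (j + 1) := fun j Φ hΦ => by
    calc B * K * dist Φ (p j Φ) ≤ B * K * ((1 / 2) ^ (j + 1) / K) := by
          gcongr; exact hpd j Φ hΦ
      _ = _ := by field_simp
  have hpS : ∀ j, ∀ Φ ∈ S, p j Φ ∈ S := fun j Φ hΦ => hTS j _ (hpT j Φ hΦ)
  let bad : ℕ → Set Ω := fun k => ⋃ Ψ ∈ T k, {ω | t k < |gap D (G k Ψ) (fun i => X i ω)|}
  have hlink : ∀ k, ∀ Ψ ∈ T k, P.real {ω | t k < |gap D (G k Ψ) (fun i => X i ω)|} ≤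
      2 * Real.exp (-(m * (((k : ℝ) + 3) / 2 * R) ^ 2) / (2 * B ^ 2)) := by
    intro k Ψ hΨ
    have hΨS := hTS k Ψ hΨ
    have ht : 0 ≤ t k := by positivity
    have hmeas : Measurable (G k Ψ) := by
      cases k with
      | zero => exact hg Ψ hΨS
      | succ j => exact (hg Ψ hΨS).sub (hg _ (hpS j Ψ hΨS))
    have hrange : ∃ a, ∀ᵐ z ∂D, G k Ψ z ∈ Set.Icc a (a + 2 * ((1 / 2) ^ k * B)) := by
      cases k with
      | zero =>
        refine ⟨0, hbdd.mono fun z hz => ?_⟩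
        simpa [G] using hz Ψ hΨS
      | succ j =>
        refine ⟨-((1 / 2) ^ (j + 1) * B), hlip.mono fun z hz => ?_⟩
        have h1 := abs_le.1 ((hz Ψ hΨS _ (hpS j Ψ hΨS)).trans (hstep j Ψ hΨS))
        constructor <;> simp only [G, Pi.sub_apply] <;> linarith [h1.1, h1.2]
    obtain ⟨a, ha⟩ := hrange
    refine (measureReal_lt_abs_gap hm hX hind hlaw hmeas (by positivity) ha ht).trans_eq ?_
    congr 2
    simp only [t]
    field_simp
  have hbad : ∀ k, P (bad k) ≤ ENNReal.ofReal (δ / 2 * (1 / 2) ^ k) := by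
    intro k
    rw [← ofReal_measureReal (measure_ne_top P _)]
    refine ENNReal.ofReal_le_ofReal ?_
    refine (measureReal_biUnion_finset_le _ _).trans ((Finset.sum_le_sum (hlink k)).trans ?_)
    rw [Finset.sum_const, nsmul_eq_mul]
    exact hcard k
  -- One null set serves the uncountable family, because the Lipschitz hypothesis quantifies over
  -- parameters inside the almost-everywhere statement.
  let null : Set Ω := {ω | ¬ ∀ i, (∀ Φ ∈ S, ∀ Ψ ∈ S, |g Φ (X i ω) - g Ψ (X i ω)| ≤
    B * K * dist Φ Ψ)}
  have hnull : P null = 0 := by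
    refine ae_iff.1 (ae_all_iff.2 fun i => ?_)
    exact ae_of_ae_map (hX i).aemeasurable (by rwa [hlaw i])
  have hincl : {ω | ¬ ∀ Φ ∈ S, |gap D (g Φ) (fun i => X i ω)| ≤ 4 * R} ⊆
      null ∪ ⋃ k, bad k := by
    intro ω hω
    by_contra hgood
    simp only [Set.mem_union, Set.mem_iUnion, bad, null, Set.mem_ofPred_eq, not_or, not_exists,
      not_not, not_lt] at hgood
    obtain ⟨hX', hgap⟩ := hgood
    refine hω ?_
    have hnet : ∀ k, ∀ Ψ ∈ T k, |gap D (g Ψ) (fun i => X i ω)| ≤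
        ∑ j ∈ Finset.range (k + 1), t j := by
      intro k
      induction k with
      | zero => intro Ψ hΨ; simpa [G] using hgap 0 Ψ hΨ
      | succ j ih =>
        intro Ψ hΨ
        have hΨS := hTS _ Ψ hΨ
        have h1 := hgap (j + 1) Ψ hΨ
        have h2 := ih _ (hpT j Ψ hΨS)
        simp only [G] at h1
        rw [gap_sub (hint Ψ hΨS) (hint _ (hpS j Ψ hΨS))] at h1
        rw [Finset.sum_range_succ]
        have := abs_sub_abs_le_abs_sub (gap D (g Ψ) fun i => X i ω)
          (gap D (g (p j Ψ)) fun i => X i ω)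
        linarith
    have hsum : ∀ k, ∑ j ∈ Finset.range k, t j ≤ 4 * R := by
      intro k
      rw [← Finset.sum_mul, sum_range_chaining_weights]
      gcongr
      have : (0 : ℝ) ≤ (1 / 2) ^ k * (k + 4) := by positivity
      linarith
    intro Φ hΦ
    -- An arbitrary parameter is compared with net k directly; the error B·2^{-k} vanishes as k → ∞.
    have happrox : ∀ k : ℕ, |gap D (g Φ) (fun i => X i ω)| ≤ 4 * R + B * (1 / 2) ^ k := by
      intro k
      have hΨS := hpS k Φ hΦ
      have h1 : |gap D (g Φ - g (p k Φ)) (fun i => X i ω)| ≤ 2 * (B * (1 / 2) ^ (k + 1)) :=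
        abs_gap_le hm (hlip.mono fun z hz => (hz Φ hΦ _ hΨS).trans (hstep k Φ hΦ))
          fun i => (hX' i Φ hΦ _ hΨS).trans (hstep k Φ hΦ)
      rw [gap_sub (hint Φ hΦ) (hint _ hΨS)] at h1
      have h2 := (hnet k _ (hpT k Φ hΦ)).trans (hsum _)
      have := abs_sub_abs_le_abs_sub (gap D (g Φ) fun i => X i ω)
        (gap D (g (p k Φ)) fun i => X i ω)
      rw [pow_succ] at h1
      linarith
    have hlim : Filter.Tendsto (fun k : ℕ => 4 * R + B * (1 / 2 : ℝ) ^ k) Filter.atTop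
        (nhds (4 * R + B * 0)) :=
      ((tendsto_pow_atTop_nhds_zero_of_lt_one (by norm_num) (by norm_num)).const_mul B).const_add _
    simpa using ge_of_tendsto' hlim happrox
  calc P {ω | ¬ ∀ Φ ∈ S, |gap D (g Φ) (fun i => X i ω)| ≤ 4 * R}
      ≤ P (null ∪ ⋃ k, bad k) := measure_mono hincl
    _ ≤ P null + P (⋃ k, bad k) := measure_union_le _ _
    _ ≤ 0 + ∑' k, P (bad k) := by rw [hnull]; gcongr; exact measure_iUnion_le _
    _ ≤ ∑' k, ENNReal.ofReal (δ / 2 * (1 / 2) ^ k) := by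
        rw [zero_add]; exact ENNReal.tsum_le_tsum hbad
    _ = ENNReal.ofReal (∑' k : ℕ, δ / 2 * (1 / 2) ^ k) :=
        (ENNReal.ofReal_tsum_of_nonneg (fun k => by positivity)
          (summable_geometric_two.mul_left _)).symm
    _ = ENNReal.ofReal δ := by rw [tsum_mul_left, tsum_geometric_two]; congr 1; ring

end Chaining

/-! ### Choice of constants and the uniform bound for the networks. -/

section Generalization

/-- The left side is at most 2^k (2L+1)², and both 2 and 2L+1 are at most V = e + 8eL. The entropy
at level k is thus at most (k+2)N² log V. -/
lemma net_size_le_exp (L k : ℕ) (hL : 1 ≤ L) :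
    1 + 2 / ((1 / 2 : ℝ) ^ (k + 1) / (L * (L + 1))) ≤
      Real.exp ((k + 2) * Real.log (Real.exp 1 + 8 * Real.exp 1 * L)) := by
  have hL' : (1 : ℝ) ≤ L := by exact_mod_cast hL
  have he : (2 : ℝ) ≤ Real.exp 1 := by linarith [Real.add_one_le_exp (1 : ℝ)]
  set V := Real.exp 1 + 8 * Real.exp 1 * L with hV
  have hV1 : 2 * (L : ℝ) + 1 ≤ V := by nlinarith
  have hV2 : (2 : ℝ) ≤ V := by nlinarith
  have e1 : Real.exp ((k + 2) * Real.log V) = V ^ (k + 2) := by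
    rw [mul_comm, Real.exp_mul, Real.exp_log (by positivity)]
    exact_mod_cast Real.rpow_natCast V (k + 2)
  have e2 : 2 / ((1 / 2 : ℝ) ^ (k + 1) / (L * (L + 1))) = 2 ^ k * (4 * (L * (L + 1))) := by
    rw [one_div, inv_pow, pow_succ]; field_simp; norm_num
  rw [e1, e2, pow_add]
  have h2k : (1 : ℝ) ≤ 2 ^ k := one_le_pow₀ (by norm_num)
  calc (1 : ℝ) + 2 ^ k * (4 * (L * (L + 1))) ≤ 2 ^ k * (2 * L + 1) ^ 2 := by nlinarith
    _ ≤ V ^ k * V ^ 2 := by gcongr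

/-- The weight (k+3)/2 is chosen so that its square is at least k+2. The Hoeffding exponent then
exceeds (k+2)(N²V + ℓ/2) with ℓ = log(4/δ): the first part cancels the net size, and the second
leaves 2e^{-ℓ}e^{-kℓ/2}, where 2e^{-ℓ} = δ/2 and ℓ ≥ log 4 gives the geometric decay. -/
lemma card_mul_exp_le {N m k : ℕ} (hm : 1 ≤ m) {B δ V c : ℝ} (hB : 0 < B) (hδ : 0 < δ)
    (hδ1 : δ < 1) (hV : 0 ≤ V) (hc : c ≤ Real.exp ((k + 2) * V) ^ (N * N)) :
    c * (2 * Real.exp (-(m * (((k : ℝ) + 3) / 2 *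
      (B / √m * (√2 * (N * √V) + √(Real.log (4 / δ))))) ^ 2) / (2 * B ^ 2))) ≤
      δ / 2 * (1 / 2) ^ k := by
  have hm' : (0 : ℝ) < m := by exact_mod_cast hm
  set ℓ := Real.log (4 / δ) with hℓ
  have h4 : (4 : ℝ) ≤ 4 / δ := by rw [le_div_iff₀ hδ]; linarith
  have hℓ2 : 2 * Real.log 2 ≤ ℓ := by
    rw [hℓ, show 2 * Real.log 2 = Real.log 4 by
      rw [show (4 : ℝ) = 2 ^ 2 by norm_num, Real.log_pow]; norm_num]
    exact Real.log_le_log (by norm_num) h4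
  have hℓ0 : 0 ≤ ℓ := by linarith [Real.log_nonneg (one_le_two (α := ℝ))]
  have hexpℓ : Real.exp (-ℓ) = δ / 4 := by
    rw [Real.exp_neg, hℓ, Real.exp_log (by positivity), inv_div]
  have e1 : Real.exp ((k + 2) * V) ^ (N * N) = Real.exp ((k + 2) * (N ^ 2 * V)) := by
    rw [← Real.exp_nat_mul]; congr 1; push_cast; ring
  have e2 : m * (((k : ℝ) + 3) / 2 * (B / √m * (√2 * (N * √V) + √ℓ))) ^ 2 / (2 * B ^ 2) =
      (((k : ℝ) + 3) / 2) ^ 2 * ((√2 * (N * √V) + √ℓ) ^ 2 / 2) := by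
    rw [mul_pow, mul_pow, div_pow B, Real.sq_sqrt hm'.le]
    field_simp
  have h1 : 2 * (N ^ 2 * V) + ℓ ≤ (√2 * (N * √V) + √ℓ) ^ 2 := by
    have a1 : (√2 * (N * √V)) ^ 2 = 2 * (N ^ 2 * V) := by
      rw [mul_pow, mul_pow, Real.sq_sqrt hV, Real.sq_sqrt zero_le_two]
    have a2 : √ℓ ^ 2 = ℓ := Real.sq_sqrt hℓ0
    have a3 : 0 ≤ (√2 * (N * √V)) * √ℓ := by positivity
    nlinarith
  have h2 : (k : ℝ) + 2 ≤ (((k : ℝ) + 3) / 2) ^ 2 := by nlinarith [sq_nonneg ((k : ℝ) + 1)]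
  have h3 : (k + 2) * ((2 * (N ^ 2 * V) + ℓ) / 2) ≤
      m * (((k : ℝ) + 3) / 2 * (B / √m * (√2 * (N * √V) + √ℓ))) ^ 2 / (2 * B ^ 2) := by
    rw [e2]; gcongr
  rw [e1] at hc
  have h5 : Real.exp (-(k * (ℓ / 2))) ≤ (1 / 2) ^ k := by
    rw [← mul_neg, Real.exp_nat_mul]
    gcongr
    rw [show (1 / 2 : ℝ) = Real.exp (-Real.log 2) by
      rw [Real.exp_neg, Real.exp_log zero_lt_two, one_div]]
    exact Real.exp_le_exp.2 (by linarith)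
  calc _ ≤ Real.exp ((k + 2) * (N ^ 2 * V)) *
        (2 * Real.exp (-((k + 2) * ((2 * (N ^ 2 * V) + ℓ) / 2)))) := by
        rw [neg_div]
        gcongr
    _ = 2 * (Real.exp (-ℓ) * Real.exp (-(k * (ℓ / 2)))) := by
        rw [mul_left_comm, ← Real.exp_add, ← Real.exp_add]; congr 2; ring
    _ ≤ 2 * (δ / 4 * (1 / 2) ^ k) := by rw [hexpℓ]; gcongr
    _ = _ := by ring

variable {N n m L : ℕ} {A : Matrix (Fin n) (Fin N) ℝ} {τ lam B δ : ℝ}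
  {D : Measure (EuclideanSpace ℝ (Fin N))} [IsProbabilityMeasure D]
  {Ω : Type*} [MeasurableSpace Ω] {P : Measure Ω} [IsProbabilityMeasure P]
  {X : Fin m → Ω → EuclideanSpace ℝ (Fin N)}

/-- Two-sided uniform deviation bound over all orthogonal dictionaries. -/
theorem measure_not_forall_dictLoss_gap_le (hm : 1 ≤ m) (hL : 1 ≤ L) (hτ : 0 < τ)
    (hlam : 0 < lam) (hA : τ * ‖A‖ ^ 2 ≤ 1) (hδ : 0 < δ) (hδ1 : δ < 1)
    (hD : ∀ᵐ x ∂D, ‖x‖ ≤ B) (hX : ∀ i, Measurable (X i)) (hind : iIndepFun X P)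
    (hlaw : ∀ i, P.map (X i) = D) :
    P {ω | ¬ ∀ Φ ∈ (Matrix.orthogonalGroup (Fin N) ℝ : Set (Matrix (Fin N) (Fin N) ℝ)),
      |gap D (dictLoss A τ lam B L Φ) (fun i => X i ω)| ≤
        4 * (B / √m * (√2 * (N * √(Real.log (Real.exp 1 + 8 * Real.exp 1 * L))) +
          √(Real.log (4 / δ))))} ≤ ENNReal.ofReal δ := by
  have hB : 0 ≤ B := by
    obtain ⟨x, hx⟩ := hD.exists
    exact (norm_nonneg x).trans hx
  have hL' : (1 : ℝ) ≤ L := by exact_mod_cast hL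
  rcases hB.eq_or_lt with rfl | hBpos
  -- For B = 0 every loss vanishes almost surely; chaining requires B > 0.
  · have hae : ∀ᵐ ω ∂P, ∀ i, ‖X i ω‖ ≤ 0 :=
      ae_all_iff.2 fun i => ae_of_ae_map (hX i).aemeasurable (by rwa [hlaw i])
    refine le_of_eq_of_le (ae_iff.1 (hae.mono fun ω hω Φ hΦ => ?_)) zero_le
    have habs : ∀ x : EuclideanSpace ℝ (Fin N), ‖x‖ ≤ 0 → |dictLoss A τ lam 0 L Φ x| ≤ 0 := by
      intro x hx
      have h := dictLoss_mem_Icc A τ lam L Φ hx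
      rw [abs_of_nonneg h.1]
      simpa using h.2
    simpa using abs_gap_le hm (hD.mono habs) fun i => habs _ (hω i)
  · have hV : 0 ≤ Real.log (Real.exp 1 + 8 * Real.exp 1 * L) := by
      refine Real.log_nonneg ?_
      nlinarith [Real.add_one_le_exp (1 : ℝ)]
    have hK : (0 : ℝ) < L * (L + 1) := by positivity
    choose T hTS hcover hcard using fun k : ℕ =>
      exists_net_card_le (S := (Matrix.orthogonalGroup (Fin N) ℝ : Set (Matrix (Fin N) (Fin N) ℝ)))
        (fun Φ hΦ => norm_le_one_of_mem_orthogonalGroup hΦ)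
        (ε := (1 / 2) ^ (k + 1) / (L * (L + 1))) (by positivity)
    refine measure_not_forall_abs_gap_le hm hX hind hlaw hBpos hK
      (fun Φ hΦ => (continuous_dictLoss A (by positivity) hB L hΦ).measurable)
      (hD.mono fun x hx Φ _ => dictLoss_mem_Icc A τ lam L Φ hx)
      (hD.mono fun x hx Φ hΦ Ψ hΨ => abs_dictLoss_sub_le hτ hlam hA L hΦ hΨ hx)
      hTS hcover (by positivity) hδ.le fun k => ?_
    refine card_mul_exp_le hm hBpos hδ hδ1 hV ((hcard k).trans ?_)
    rw [Module.finrank_matrix, Module.finrank_self, mul_one, Fintype.card_fin]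
    gcongr
    exact net_size_le_exp L k hL

/-- Only subadditivity and monotonicity are used, so events quantified over uncountably many
dictionaries need not be measurable. -/
lemma one_sub_le_measureReal_of_compl {s t : Set Ω} (hδ : 0 ≤ δ)
    (h : P {ω | ω ∉ s} ≤ ENNReal.ofReal δ) (hst : s ⊆ t) : 1 - δ ≤ P.real t := by
  have h1 : P.real sᶜ ≤ δ := ENNReal.toReal_le_of_le_ofReal hδ h
  have h2 : (1 : ℝ) ≤ P.real s + P.real sᶜ := by
    rw [← probReal_univ (μ := P), ← Set.union_compl_self s]
    exact measureReal_union_le _ _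
  have h3 := measureReal_mono (μ := P) hst
  linarith

end Generalization

end UnfoldedISTA

/-- The first conjunct is the generalization bound with explicit constants; the second is the
order of the generalization gap, with an absolute constant `C`. -/
theorem mainTheorem1 :
    ∃ C : ℝ, 0 < C ∧
      ∀ (N n m L : ℕ), 1 ≤ m → 1 ≤ L →
      ∀ (A : Matrix (Fin n) (Fin N) ℝ) (τ lam Bout δ : ℝ), 0 < τ → 0 < lam →
        τ * ‖A‖ ^ 2 ≤ 1 → 0 < δ → δ < 1 →
      ∀ (D : Measure (EuclideanSpace ℝ (Fin N))), IsProbabilityMeasure D →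
        (∀ᵐ x ∂D, ‖x‖ ≤ Bout) →
      ∀ (Ω : Type*) (_ : MeasurableSpace Ω) (P : Measure Ω), IsProbabilityMeasure P →
      ∀ (X : Fin m → Ω → EuclideanSpace ℝ (Fin N)), (∀ i, Measurable (X i)) →
        iIndepFun X P → (∀ i, P.map (X i) = D) →
      (1 - δ ≤ P.real {ω | ∀ h ∈ UnfoldedISTA.hypothesisClass A τ lam Bout L,
          UnfoldedISTA.trueLoss A D h ≤
            UnfoldedISTA.empiricalLoss h (fun i => X i ω)
                (fun i => UnfoldedISTA.act A (X i ω))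
              + 8 * Bout * √((N * n * Real.log (2 + 8 * L * (L + 3))) / m)
              + 8 * Bout * (N * √(Real.log (Real.exp 1 + 8 * Real.exp 1 * L)) / √m)
              + Bout * √(128 * Real.log (4 / δ) / m)}) ∧
      (2 ≤ L → 1 - δ ≤ P.real {ω | ∀ h ∈ UnfoldedISTA.hypothesisClass A τ lam Bout L,
          |UnfoldedISTA.trueLoss A D h -
            UnfoldedISTA.empiricalLoss h (fun i => X i ω)
                (fun i => UnfoldedISTA.act A (X i ω))| ≤
            C * Bout * (√(((N * n + N ^ 2) * Real.log L) / m)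
              + √(Real.log (4 / δ) / m))}) := by
  -- 14 = 4 · 7/2: the deviation bound has the factor 4, and √(2·6) ≤ 7/2 once log(e + 8eL) ≤ 6 log
  -- L.
  refine ⟨14, by norm_num, ?_⟩
  intro N n m L hm hL A τ lam B δ hτ hlam hA hδ hδ1 D hDp hD Ω _ P hP X hX hind hlaw
  have key := UnfoldedISTA.measure_not_forall_dictLoss_gap_le hm hL hτ hlam hA hδ hδ1 hD hX hind hlaw
  have hB : 0 ≤ B := by
    obtain ⟨x, hx⟩ := hD.exists
    exact (norm_nonneg x).trans hx
  have hm' : (0 : ℝ) < m := by exact_mod_cast hm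
  have hℓ : √(Real.log (4 / δ) / m) = √(Real.log (4 / δ)) / √m := Real.sqrt_div' _ hm'.le
  have h2 : 4 * √2 ≤ 8 := by
    have : √2 ≤ 2 := Real.sqrt_le_iff.2 ⟨by norm_num, by norm_num⟩
    linarith
  constructor
  · refine UnfoldedISTA.one_sub_le_measureReal_of_compl hδ.le key ?_
    rintro ω hω h ⟨Φ, hΦ, rfl⟩
    have hgap := (abs_le.1 (hω Φ hΦ)).2
    set V := Real.log (Real.exp 1 + 8 * Real.exp 1 * L)
    have e1 : √(128 * Real.log (4 / δ) / m) = √128 * (√(Real.log (4 / δ)) / √m) := by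
      rw [mul_div_assoc, Real.sqrt_mul (by norm_num), hℓ]
    have h128 : 4 ≤ √128 := Real.le_sqrt_of_sq_le (by norm_num)
    -- The Nn term enters only through its sign.
    have t1 : 0 ≤ 8 * B * √((N * n * Real.log (2 + 8 * L * (L + 3))) / m) := by positivity
    have t2 : 4 * √2 * (B * (N * √V / √m)) ≤ 8 * (B * (N * √V / √m)) := by gcongr
    have t3 : 4 * (B * (√(Real.log (4 / δ)) / √m)) ≤
        √128 * (B * (√(Real.log (4 / δ)) / √m)) := by gcongr
    have e2 : 4 * (B / √m * (√2 * (N * √V) + √(Real.log (4 / δ)))) =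
        4 * √2 * (B * (N * √V / √m)) + 4 * (B * (√(Real.log (4 / δ)) / √m)) := by ring
    rw [e2] at hgap
    rw [e1]
    unfold UnfoldedISTA.gap UnfoldedISTA.dictLoss at hgap
    unfold UnfoldedISTA.trueLoss UnfoldedISTA.empiricalLoss
    linarith
  · intro hL2
    refine UnfoldedISTA.one_sub_le_measureReal_of_compl hδ.le key ?_
    rintro ω hω h ⟨Φ, hΦ, rfl⟩
    refine (hω Φ hΦ : |UnfoldedISTA.trueLoss A D _ - UnfoldedISTA.empiricalLoss _ _ _| ≤ _).trans ?_
    have hL2' : (2 : ℝ) ≤ L := by exact_mod_cast hL2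
    have hlogL : 0 ≤ Real.log L := Real.log_nonneg (by linarith)
    have hV : Real.log (Real.exp 1 + 8 * Real.exp 1 * L) ≤ 6 * Real.log L := by
      have h6 : 6 * Real.log L = Real.log ((L : ℝ) ^ 6) := by rw [Real.log_pow]; norm_num
      rw [h6]
      -- For L ≥ 2, e + 8eL ≤ 3 + 24L ≤ 32L ≤ L⁶.
      refine Real.log_le_log (by positivity) ?_
      have he : Real.exp 1 ≤ 3 := by linarith [Real.exp_one_lt_d9]
      have h5 : (2 : ℝ) ^ 5 ≤ (L : ℝ) ^ 5 := by gcongr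
      nlinarith [mul_le_mul_of_nonneg_right h5 (by linarith : (0 : ℝ) ≤ L)]
    have hs : √2 * √(Real.log (Real.exp 1 + 8 * Real.exp 1 * L)) ≤ 7 / 2 * √(Real.log L) := by
      rw [← Real.sqrt_mul zero_le_two]
      refine Real.sqrt_le_iff.2 ⟨by positivity, ?_⟩
      rw [mul_pow, Real.sq_sqrt hlogL]
      linarith
    have hN : N * √(Real.log L) / √m ≤ √(((N * n + N ^ 2) * Real.log L) / m) := by
      rw [Real.sqrt_div' _ hm'.le]
      gcongr
      refine Real.le_sqrt_of_sq_le ?_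
      rw [mul_pow, Real.sq_sqrt hlogL]
      gcongr
      exact le_add_of_nonneg_left (by positivity)
    rw [hℓ]
    calc 4 * (B / √m * (√2 * (N * √(Real.log (Real.exp 1 + 8 * Real.exp 1 * L))) +
          √(Real.log (4 / δ))))
        = 4 * (B * (N * (√2 * √(Real.log (Real.exp 1 + 8 * Real.exp 1 * L))) / √m)) +
          4 * (B * (√(Real.log (4 / δ)) / √m)) := by ring
      _ ≤ 4 * (B * (N * (7 / 2 * √(Real.log L)) / √m)) +
          14 * (B * (√(Real.log (4 / δ)) / √m)) := by
        gcongr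
        norm_num
      _ = 14 * B * (N * √(Real.log L) / √m + √(Real.log (4 / δ)) / √m) := by ring
      _ ≤ _ := by gcongr
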